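/- A Motzkin path of length $n$ is a sequence $mz=(mz_1,\dots,mz_n)$ of moves $U$ (height $+1$), $H$ (height $+0$), $D$ (height $-1$) that starts at height $0$, never goes below height $0$ and ends at height $0$. A permutation $\pi$ of $\{1,\dots,n\}$ maps into $mz$ if, for every $i$: $mz_i=U$ when $\pi(i)>i<\pi^{-1}(i)$, $mz_i=D$ when $\pi(i)<i>\pi^{-1}(i)$, and $mz_i=H$ otherwise. Let $h_i$ be the maximum height of the path during move $i$, and let $\omega(mz)=\prod_{i=1}^n\omega_i$, where $\omega_i=h_i$ if $mz_i\in\{U,D\}$ and $\omega_i=2h_i+1$ if $mz_i=H$. Then, for every Motzkin path $mz$ of length $n$, exactly $\omega(mz)$ permutations map into $mz$, and one of them can be sampled uniformly at random in time $\mathcal{O}(n)$. That is, there are a single randomized algorithm and a constant $C$ such that, for every $n\ge 0$ and every Motzkin path $mz$ of length $n$ given as input, the algorithm halts after at most $C(n+1)$ steps, whatever its random choices, and outputs each permutation that maps into $mz$ with probability exactly $1/\omega(mz)$, and every other permutation with probability $0$. Here an algorithm is a program for a random access machine that performs, in one step each, loading a constant, addition, truncated subtraction, indirect load and store, jumps,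 a comparison with a conditional jump, and drawing a fresh uniformly random element of $\{0,\dots,k\}$ for a number $k$ held in a register; all numbers handled have $\mathcal{O}(\log n)$ bits (they are at most $(n+2)^C$). -/

import Mathlib

/-! ### Motzkin paths -/

/-- The three moves of a Motzkin path: up-right, horizontal-right, down-right. -/
inductive Move where
  | U
  | H
  | D
  deriving DecidableEq

/-- The change of height caused by a move. -/
def Move.rise : Move → ℤ
  | .U => 1
  | .H => 0
  | .D => -1

/-- The height reached after the first `k` moves of a sequence of moves that starts at height `0`. -/
def heightAfter {n : ℕ} (w : Fin n → Move) (k : ℕ) : ℤ :=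
  ∑ i : Fin n with i.val < k, (w i).rise

/-- A Motzkin path of length (width) `n`: it never goes below height `0` and ends at height `0`. -/
structure MotzkinPath (n : ℕ) where
  move : Fin n → Move
  nonneg : ∀ k ≤ n, 0 ≤ heightAfter move k
  final : heightAfter move n = 0

/-- The maximum height of the path during move `i` (a nonnegative integer, hence `toNat`). -/
def MotzkinPath.moveHeight {n : ℕ} (mz : MotzkinPath n) (i : Fin n) : ℕ :=
  (max (heightAfter mz.move i.val) (heightAfter mz.move (i.val + 1))).toNat

/-- The factor that move `i` contributes to the weight. -/
def MotzkinPath.moveWeight {n : ℕ} (mz : MotzkinPath n) (i : Fin n) : ℕ :=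
  match mz.move i with
  | .U => mz.moveHeight i
  | .D => mz.moveHeight i
  | .H => 2 * mz.moveHeight i + 1

/-- The weight `ω(mz)`. -/
def MotzkinPath.weight {n : ℕ} (mz : MotzkinPath n) : ℕ :=
  ∏ i : Fin n, mz.moveWeight i

/-- The sequence of moves assigned to a permutation: element `i` gives `U` if
`π(i) > i < π⁻¹(i)`, gives `D` if `π(i) < i > π⁻¹(i)`, and gives `H` otherwise. -/
def permMoves {n : ℕ} (π : Equiv.Perm (Fin n)) (i : Fin n) : Move :=
  if i < π i ∧ i < π.symm i then .U
  else if π i < i ∧ π.symm i < i then .D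
  else .H

/-- The permutation `π` maps into the Motzkin path `mz`. -/
def MapsInto {n : ℕ} (π : Equiv.Perm (Fin n)) (mz : MotzkinPath n) : Prop :=
  permMoves π = mz.move

/-! ### Random access machines with a source of randomness, at unit cost -/

/-- The instructions of the machine. Registers are named by fixed numbers; memory cells are
addressed by the contents of registers. Labels are positions in the program. -/
inductive Instr where
  /-- `const d k`: put the constant `k` into register `d`. -/
  | const (d k : ℕ)
  /-- `add d a b`: put the sum of registers `a` and `b` into register `d`. -/
  | add (d a b : ℕ)
  /-- `sub d a b`: put the truncated difference of registers `a` and `b` into register `d`. -/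
  | sub (d a b : ℕ)
  /-- `load d a`: put the memory cell whose address is in register `a` into register `d`. -/
  | load (d a : ℕ)
  /-- `store a b`: put register `b` into the memory cell whose address is in register `a`. -/
  | store (a b : ℕ)
  /-- `jump l`: continue at position `l`. -/
  | jump (l : ℕ)
  /-- `jumpLt a b l`: continue at position `l` if register `a` is smaller than register `b`. -/
  | jumpLt (a b l : ℕ)
  /-- `rand d a`: put into register `d` a fresh random number, uniform on `{0, …, k}`, where
  `k` is the content of register `a`. -/
  | rand (d a : ℕ)

/-- A program is a finite list of instructions. -/
abbrev Program := List Instr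

/-- A configuration of the machine: program counter, registers and memory. -/
@[ext]
structure Config where
  pc : ℕ
  reg : ℕ → ℕ
  mem : ℕ → ℕ

namespace Config

/-- Write `v` into register `d` and go to the next instruction. -/
def setReg (c : Config) (d v : ℕ) : Config :=
  ⟨c.pc + 1, Function.update c.reg d v, c.mem⟩

/-- Write `v` into the memory cell `x` and go to the next instruction. -/
def setMem (c : Config) (x v : ℕ) : Config :=
  ⟨c.pc + 1, c.reg, Function.update c.mem x v⟩

/-- Continue at position `l`. -/
def goto (c : Config) (l : ℕ) : Config :=
  ⟨l, c.reg, c.mem⟩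

/-- The machine has halted when the program counter points to no instruction. -/
def Halted (P : Program) (c : Config) : Prop :=
  P[c.pc]? = none

/-- All registers and memory cells hold numbers that are at most `W`. -/
def BoundedBy (W : ℕ) (c : Config) : Prop :=
  ∀ j, c.reg j ≤ W ∧ c.mem j ≤ W

end Config

/-- The distribution of the configuration after the execution of one instruction. -/
noncomputable def Instr.exec (c : Config) : Instr → PMF Config
  | .const d k => PMF.pure (c.setReg d k)
  | .add d a b => PMF.pure (c.setReg d (c.reg a + c.reg b))
  | .sub d a b => PMF.pure (c.setReg d (c.reg a - c.reg b))
  | .load d a => PMF.pure (c.setReg d (c.mem (c.reg a)))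
  | .store a b => PMF.pure (c.setMem (c.reg a) (c.reg b))
  | .jump l => PMF.pure (c.goto l)
  | .jumpLt a b l => PMF.pure (if c.reg a < c.reg b then c.goto l else c.goto (c.pc + 1))
  | .rand d a => (PMF.uniformOfFintype (Fin (c.reg a + 1))).map fun x => c.setReg d x.val

/-- The distribution of the configuration after one step; a halted machine does not move. -/
noncomputable def Program.step (P : Program) (c : Config) : PMF Config :=
  match P[c.pc]? with
  | none => PMF.pure c
  | some ins => ins.exec c

/-- The distribution of the configuration after `t` steps. -/
noncomputable def Program.run (P : Program) : ℕ → Config → PMF Config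
  | 0, c => PMF.pure c
  | t + 1, c => (P.step c).bind (P.run t)

/-! ### Input and output -/

/-- The number that represents a move in the memory. -/
def Move.code : Move → ℕ
  | .U => 0
  | .H => 1
  | .D => 2

/-- The initial configuration: the length `n` is in register `0`, the moves are in the memory
cells `0, …, n - 1`, and everything else is `0`. -/
def MotzkinPath.initial {n : ℕ} (mz : MotzkinPath n) : Config where
  pc := 0
  reg := fun j => if j = 0 then n else 0
  mem := fun j => if h : j < n then (mz.move ⟨j, h⟩).code else 0

/-- The output: the contents of the memory cells `0, …, n - 1`. -/
def Config.output (n : ℕ) (c : Config) : Fin n → ℕ :=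
  fun i => c.mem i.val

/-- The program `P` halts on the input `mz` after at most `T` steps, whatever the random choices. -/
def HaltsWithin (P : Program) {n : ℕ} (mz : MotzkinPath n) (T : ℕ) : Prop :=
  ∀ c ∈ (P.run T mz.initial).support, c.Halted P

/-- Throughout the computation on the input `mz`, whatever the random choices, the machine
handles only numbers that are at most `W`. -/
def UsesWordsUpTo (P : Program) {n : ℕ} (mz : MotzkinPath n) (W : ℕ) : Prop :=
  ∀ t, ∀ c ∈ (P.run t mz.initial).support, c.BoundedBy W

/-- The probability that after `t` steps on the input `mz` the output is the permutation `π`,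
given by the list of its values. -/
noncomputable def outputProb (P : Program) {n : ℕ} (mz : MotzkinPath n) (t : ℕ)
    (π : Equiv.Perm (Fin n)) : ENNReal :=
  (P.run t mz.initial).map (Config.output n) (fun i => (π i).val)

/-! Reveal a permutation by inserting the elements in increasing order, recording after step `i`
only the pairs `(x, π x)` with both entries below `i`. At height `h` there are `h` elements waiting
for an image and `h` waiting for a preimage. An up move leaves `i` open at both ends. A horizontal
move closes one end of `i` against one of the `h` open elements on either side, or makes `i` a fixed
point: `2h + 1` possibilities. A down move closes both ends: `h * h` possibilities. Every
permutation that maps into the path arises from exactly one sequence of such choices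
(`Represents.pushMem_iff`, `Represents.exists_memH`, `Represents.exists_memD`).

The product of these numbers is the weight: down moves count `h` once too often and up moves not at
all, and the surplus is a factorial of the current height, which is `1` at the end
(`MotzkinPath.prod_moveWeight`).

The sampler draws the choices uniformly. Keeping the open elements in two stacks, with deletion by
moving the last entry into the gap, makes each move cost constant time. Backward induction over the
moves gives each admissible permutation probability `1 / ω` and every other one `0`
(`Stage.map_output`). Since every output is a permutation, the probabilities sum to `1`, so the
count of admissible permutations is a consequence of the distribution (`card_mapsInto`). -/

/-! ### Partial bijections stored in memory, with two stacks of open elements -/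

/-- The cell of the `k`-th entry of the stack of elements whose image is still open. -/
def cellA (n k : ℕ) : ℕ := k + k + n

/-- The cell of the `k`-th entry of the stack of elements whose preimage is still open. -/
def cellB (n k : ℕ) : ℕ := k + k + n + 1

/-- The memory `m` represents the partial bijection `S` of `{0, …, N - 1}`, with the elements
outside the domain and outside the range listed in two stacks of height `h`. -/
structure Represents (n : ℕ) (m : ℕ → ℕ) (N h : ℕ) (S : ℕ → ℕ → Prop) : Prop where
  lt : ∀ x y, S x y → x < N ∧ y < N
  val : ∀ x y, S x y → m x = y
  inj : ∀ x x' y, S x y → S x' y → x = x'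
  A_lt : ∀ k < h, m (cellA n k) < N
  A_inj : ∀ k < h, ∀ l < h, m (cellA n k) = m (cellA n l) → k = l
  A_open : ∀ k < h, ∀ y, ¬ S (m (cellA n k)) y
  A_surj : ∀ x < N, (∀ y, ¬ S x y) → ∃ k < h, m (cellA n k) = x
  B_lt : ∀ k < h, m (cellB n k) < N
  B_inj : ∀ k < h, ∀ l < h, m (cellB n k) = m (cellB n l) → k = l
  B_open : ∀ k < h, ∀ x, ¬ S x (m (cellB n k))
  B_surj : ∀ y < N, (∀ x, ¬ S x y) → ∃ k < h, m (cellB n k) = y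

/-- Push the element `i` on both stacks, which have height `h`. -/
def pushMem (n h i : ℕ) (m : ℕ → ℕ) : ℕ → ℕ :=
  Function.update (Function.update m (cellA n h) i) (cellB n h) i

/-- Make the `b`-th entry of the second stack the image of the `a`-th entry of the first one, and
replace both entries by the last ones, which have index `h`. -/
def linkMem (n h a b : ℕ) (m : ℕ → ℕ) : ℕ → ℕ :=
  let m₁ := Function.update m (m (cellA n a)) (m (cellB n b))
  let m₂ := Function.update m₁ (cellA n a) (m₁ (cellA n h))
  Function.update m₂ (cellB n b) (m₂ (cellB n h))

/-- The relation `S` with the pair `(x, y)` added. -/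
def addPair (S : ℕ → ℕ → Prop) (x y : ℕ) : ℕ → ℕ → Prop :=
  fun u v => S u v ∨ (u = x ∧ v = y)

/-- The first stack determines the domain as its complement in `{0, …, N - 1}`, and the memory cells
give the values there. -/
theorem Represents.unique {n m N h S S'} (H : Represents n m N h S) (H' : Represents n m N h S') : S = S' := by
  have key : ∀ {S S' : ℕ → ℕ → Prop}, Represents n m N h S → Represents n m N h S' →
      ∀ x y, S x y → S' x y := by
    intro S S' H H' x y hs
    by_contra hn
    have hx := (H.lt _ _ hs).1
    by_cases hy : ∀ z, ¬ S' x z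
    · obtain ⟨k, hk, rfl⟩ := H'.A_surj x hx hy
      exact H.A_open k hk _ hs
    · push Not at hy
      obtain ⟨z, hz⟩ := hy
      have h1 := H.val _ _ hs
      have h2 := H'.val _ _ hz
      subst h1; subst h2
      exact hn hz
  funext x y
  exact propext ⟨key H H' x y, key H' H x y⟩

theorem pushMem_of_lt {n h i : ℕ} {m : ℕ → ℕ} {j : ℕ} (hj : j < n) :
    pushMem n h i m j = m j := by
  rw [pushMem, Function.update_of_ne, Function.update_of_ne] <;> simp only [cellA, cellB] <;> omega

theorem pushMem_cellA {n h i : ℕ} {m : ℕ → ℕ} (k : ℕ) :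
    pushMem n h i m (cellA n k) = if k = h then i else m (cellA n k) := by
  simp only [pushMem, Function.update_apply, cellA, cellB]
  split_ifs <;> first | rfl | omega

theorem pushMem_cellB {n h i : ℕ} {m : ℕ → ℕ} (k : ℕ) :
    pushMem n h i m (cellB n k) = if k = h then i else m (cellB n k) := by
  simp only [pushMem, Function.update_apply, cellA, cellB]
  split_ifs <;> first | rfl | omega

theorem Represents.push {n m N h S} (H : Represents n m N h S) (hN : N < n) :
    Represents n (pushMem n h N m) (N + 1) (h + 1) S := by
  constructor
  · intro x y hs; have := H.lt _ _ hs; omega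
  · intro x y hs
    rw [pushMem_of_lt (by have := H.lt _ _ hs; omega)]
    exact H.val _ _ hs
  · exact H.inj
  · intro k hk
    rw [pushMem_cellA]
    split_ifs
    · omega
    · have := H.A_lt k (by omega); omega
  · intro k hk l hl
    simp only [pushMem_cellA]
    have := H.A_lt k; have := H.A_lt l; have := H.A_inj k
    grind
  · intro k hk y
    rw [pushMem_cellA]
    split_ifs
    · intro hs; have := H.lt _ _ hs; omega
    · exact H.A_open k (by omega) y
  · intro x hx hy
    by_cases hxN : x = N
    · exact ⟨h, by omega, by rw [pushMem_cellA, if_pos rfl, hxN]⟩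
    · obtain ⟨k, hk, e⟩ := H.A_surj x (by omega) hy
      exact ⟨k, by omega, by rw [pushMem_cellA, if_neg (by omega), e]⟩
  · intro k hk
    rw [pushMem_cellB]
    split_ifs
    · omega
    · have := H.B_lt k (by omega); omega
  · intro k hk l hl
    simp only [pushMem_cellB]
    have := H.B_lt k; have := H.B_lt l; have := H.B_inj k
    grind
  · intro k hk y
    rw [pushMem_cellB]
    split_ifs
    · intro hs; have := H.lt _ _ hs; omega
    · exact H.B_open k (by omega) y
  · intro x hx hy
    by_cases hxN : x = N
    · exact ⟨h, by omega, by rw [pushMem_cellB, if_pos rfl, hxN]⟩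
    · obtain ⟨k, hk, e⟩ := H.B_surj x (by omega) hy
      exact ⟨k, by omega, by rw [pushMem_cellB, if_neg (by omega), e]⟩

section link

variable {n h a b : ℕ} {m : ℕ → ℕ}

theorem linkMem_of_lt {j : ℕ} (hj : j < n) :
    linkMem n h a b m j = if j = m (cellA n a) then m (cellB n b) else m j := by
  simp only [linkMem]
  rw [Function.update_of_ne, Function.update_of_ne, Function.update_apply] <;>
    simp only [cellA, cellB] <;> omega

/-- The bound `hx` keeps the recorded image in the output area below `n`, away from the interleaved
stacks. -/
theorem linkMem_cellA (hx : m (cellA n a) < n) (k : ℕ) :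
    linkMem n h a b m (cellA n k) = if k = a then m (cellA n h) else m (cellA n k) := by
  simp only [linkMem, Function.update_apply, cellA, cellB] at hx ⊢
  split_ifs <;> first | rfl | omega

theorem linkMem_cellB (hx : m (cellA n a) < n) (k : ℕ) :
    linkMem n h a b m (cellB n k) = if k = b then m (cellB n h) else m (cellB n k) := by
  simp only [linkMem, Function.update_apply, cellA, cellB] at hx ⊢
  split_ifs <;> first | rfl | omega

/-- The order of a stack is irrelevant, so an entry is deleted by overwriting it with the last one;
for `a = h` or `b = h` this changes nothing and the entry simply falls off the top. -/
theorem Represents.link {N S} (H : Represents n m N (h + 1) S) (hN : N ≤ n) (ha : a ≤ h) (hb : b ≤ h) :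
    Represents n (linkMem n h a b m) N h (addPair S (m (cellA n a)) (m (cellB n b))) := by
  have hA := H.A_lt a (by omega)
  have hB := H.B_lt b (by omega)
  have hx : m (cellA n a) < n := by omega
  have hAo := H.A_open a (by omega)
  have hBo := H.B_open b (by omega)
  constructor
  · rintro x y (hs | ⟨rfl, rfl⟩)
    · exact H.lt _ _ hs
    · exact ⟨hA, hB⟩
  · rintro x y (hs | ⟨rfl, rfl⟩)
    · rw [linkMem_of_lt (by have := H.lt _ _ hs; omega), if_neg, H.val _ _ hs]
      rintro rfl; exact hAo _ hs
    · rw [linkMem_of_lt hx, if_pos rfl]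
  · rintro x x' y (hs | ⟨rfl, rfl⟩) (hs' | ⟨rfl, e⟩)
    · exact H.inj _ _ _ hs hs'
    · subst e; exact (hBo _ hs).elim
    · exact (hBo _ hs').elim
    · rfl
  · intro k hk
    rw [linkMem_cellA hx]
    split_ifs <;> exact H.A_lt _ (by omega)
  · intro k hk l hl
    rw [linkMem_cellA hx, linkMem_cellA hx]
    have h1 := H.A_inj h (by omega) l (by omega)
    have h2 := H.A_inj k (by omega) h (by omega)
    have h3 := H.A_inj k (by omega) l (by omega)
    split_ifs <;> omega
  · intro k hk y
    rw [linkMem_cellA hx]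
    split_ifs with hka
    · rintro (hs | ⟨e, -⟩)
      · exact H.A_open h (by omega) _ hs
      · have := H.A_inj h (by omega) a (by omega) e; omega
    · rintro (hs | ⟨e, -⟩)
      · exact H.A_open k (by omega) _ hs
      · have := H.A_inj k (by omega) a (by omega) e; omega
  · intro x hxN hy
    obtain ⟨k, hk, rfl⟩ := H.A_surj x hxN (fun y hs => hy y (Or.inl hs))
    have hka : k ≠ a := by rintro rfl; exact hy _ (Or.inr ⟨rfl, rfl⟩)
    by_cases hkh : k = h
    · exact ⟨a, by omega, by rw [linkMem_cellA hx, if_pos rfl, hkh]⟩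
    · exact ⟨k, by omega, by rw [linkMem_cellA hx, if_neg hka]⟩
  · intro k hk
    rw [linkMem_cellB hx]
    split_ifs <;> exact H.B_lt _ (by omega)
  · intro k hk l hl
    rw [linkMem_cellB hx, linkMem_cellB hx]
    have h1 := H.B_inj h (by omega) l (by omega)
    have h2 := H.B_inj k (by omega) h (by omega)
    have h3 := H.B_inj k (by omega) l (by omega)
    split_ifs <;> omega
  · intro k hk y
    rw [linkMem_cellB hx]
    split_ifs with hka
    · rintro (hs | ⟨-, e⟩)
      · exact H.B_open h (by omega) _ hs
      · have := H.B_inj h (by omega) b (by omega) e; omega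
    · rintro (hs | ⟨-, e⟩)
      · exact H.B_open k (by omega) _ hs
      · have := H.B_inj k (by omega) b (by omega) e; omega
  · intro x hxN hy
    obtain ⟨k, hk, rfl⟩ := H.B_surj x hxN (fun y hs => hy y (Or.inl hs))
    have hka : k ≠ b := by rintro rfl; exact hy _ (Or.inr ⟨rfl, rfl⟩)
    by_cases hkh : k = h
    · exact ⟨b, by omega, by rw [linkMem_cellB hx, if_pos rfl, hkh]⟩
    · exact ⟨k, by omega, by rw [linkMem_cellB hx, if_neg hka]⟩

theorem linkMem_le {W : ℕ} (hm : ∀ j, m j ≤ W) (j : ℕ) : linkMem n h a b m j ≤ W := by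
  have h1 : ∀ {m : ℕ → ℕ} {x v : ℕ}, (∀ j, m j ≤ W) → v ≤ W → ∀ j, Function.update m x v j ≤ W := by
    intro m x v hm hv j
    rw [Function.update_apply]
    split_ifs
    · exact hv
    · exact hm j
  exact h1 (h1 (h1 hm (hm _)) (h1 hm (hm _) _)) (h1 (h1 hm (hm _)) (h1 hm (hm _) _) _) j

theorem pushMem_le {W i : ℕ} (hm : ∀ j, m j ≤ W) (hi : i ≤ W) (j : ℕ) : pushMem n h i m j ≤ W := by
  simp only [pushMem, Function.update_apply]
  split_ifs <;> simp [hi, hm]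

end link

/-! ### How the restriction of a permutation grows at element `i`, by type of move -/

/-- The restriction of a permutation to the pairs in `{0, …, i - 1}`. -/
def Restr {n : ℕ} (π : Equiv.Perm (Fin n)) (i : ℕ) : ℕ → ℕ → Prop :=
  fun x y => ∃ j : Fin n, j.val = x ∧ (π j).val = y ∧ x < i ∧ y < i

section restr

variable {n : ℕ} (π : Equiv.Perm (Fin n)) (i : Fin n)

theorem restr_succ (u v : ℕ) : Restr π (i.val + 1) u v ↔ Restr π i.val u v ∨
    (u = i.val ∧ v = (π i).val ∧ v ≤ i.val) ∨ (u = (π.symm i).val ∧ v = i.val ∧ u ≤ i.val) := by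
  constructor
  · rintro ⟨j, rfl, rfl, h1, h2⟩
    by_cases hj : j = i
    · subst hj; right; left; exact ⟨rfl, rfl, by omega⟩
    by_cases hp : π j = i
    · subst hp; right; right; simp; omega
    have h3 : j.val ≠ i.val := fun e => hj (Fin.ext e)
    have h4 : (π j).val ≠ i.val := fun e => hp (Fin.ext e)
    left; exact ⟨j, rfl, rfl, by omega, by omega⟩
  · rintro (⟨j, rfl, rfl, h1, h2⟩ | ⟨rfl, rfl, h⟩ | ⟨rfl, rfl, h⟩)
    · exact ⟨j, rfl, rfl, by omega, by omega⟩
    · exact ⟨i, rfl, rfl, by omega, by omega⟩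
    · exact ⟨π.symm i, rfl, by simp, by omega, by omega⟩

theorem restr_lt {i : ℕ} (u v : ℕ) (h : Restr π i u v) : u < i ∧ v < i := by
  obtain ⟨j, -, -, h⟩ := h; exact h

theorem not_restr_symm (v : ℕ) : ¬ Restr π i.val (π.symm i).val v := by
  rintro ⟨j, h1, rfl, -, h2⟩
  have := Fin.ext h1
  subst this
  simp at h2

theorem not_restr_apply (u : ℕ) : ¬ Restr π i.val u (π i).val := by
  rintro ⟨j, rfl, h1, h2, -⟩
  have := π.injective (Fin.ext h1)
  subst this
  simp at h2

theorem apply_eq_iff_symm : (π i).val = i.val ↔ (π.symm i).val = i.val := by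
  rw [← Fin.ext_iff, ← Fin.ext_iff, Equiv.symm_apply_eq, eq_comm]

theorem permMoves_eq_U : permMoves π i = .U ↔ i.val < (π i).val ∧ i.val < (π.symm i).val := by
  unfold permMoves
  simp only [Fin.lt_def]
  split_ifs <;> grind

theorem permMoves_eq_D : permMoves π i = .D ↔ (π i).val < i.val ∧ (π.symm i).val < i.val := by
  unfold permMoves
  simp only [Fin.lt_def]
  split_ifs <;> grind

theorem permMoves_eq_H : permMoves π i = .H ↔ ¬ (i.val < (π i).val ∧ i.val < (π.symm i).val) ∧
    ¬ ((π i).val < i.val ∧ (π.symm i).val < i.val) := by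
  rw [← permMoves_eq_U, ← permMoves_eq_D]
  cases permMoves π i <;> simp

variable {π i} {S : ℕ → ℕ → Prop}

/-- Separates old from new: the pairs of `E` all involve `i` and those of `S` do not, so the pairs
avoiding `i` can be compared on their own. -/
theorem eq_restr_of_lt (hS : ∀ x y, S x y → x < i.val ∧ y < i.val) {E : ℕ → ℕ → Prop}
    (hE : ∀ u v, E u v → u = i.val ∨ v = i.val)
    (h : ∀ u v, Restr π (i.val + 1) u v ↔ S u v ∨ E u v) : S = Restr π i.val := by
  funext u v
  apply propext
  have h1 := h u v
  rw [restr_succ] at h1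
  have h2 := hS u v
  have h3 := restr_lt π (i := i.val) u v
  have h4 := hE u v
  constructor
  · intro hs
    have := h2 hs
    rcases h1.2 (Or.inl hs) with h | ⟨rfl, _⟩ | ⟨_, rfl, _⟩
    · exact h
    · omega
    · omega
  · intro hr
    have := h3 hr
    rcases h1.1 (Or.inl hr) with h | h
    · exact h
    · have := h4 h; omega

theorem eq_restr_succ_iff_U (hS : ∀ x y, S x y → x < i.val ∧ y < i.val) :
    S = Restr π (i.val + 1) ↔ S = Restr π i.val ∧ permMoves π i = .U := by
  rw [permMoves_eq_U]
  constructor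
  · intro h
    refine ⟨eq_restr_of_lt hS (E := fun _ _ => False) (by simp) (by simp [h]), ?_⟩
    have h1 := (restr_succ π i i (π i)).2
    have h2 := (restr_succ π i (π.symm i) i).2
    rw [← h] at h1 h2
    have h3 := hS i (π i)
    have h4 := hS (π.symm i) i
    constructor
    · by_contra hc
      have := h3 (h1 (Or.inr (Or.inl ⟨rfl, rfl, by omega⟩))); omega
    · by_contra hc
      have := h4 (h2 (Or.inr (Or.inr ⟨rfl, rfl, by omega⟩))); omega
  · rintro ⟨h, h1, h2⟩
    funext u v
    apply propext
    rw [restr_succ, h]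
    constructor
    · exact Or.inl
    · rintro (h | h | h)
      · exact h
      · omega
      · omega

/-- A horizontal move completes exactly one pair through `i`: were neither `(i, π i)` nor `(π⁻¹ i,
i)` in range, the move would be up; were both in range and distinct, down. At a fixed point the two
coincide. -/
theorem addPair_eq_restr_succ_iff (hS : ∀ x y, S x y → x < i.val ∧ y < i.val) {x y : ℕ}
    (hxy : x = i.val ∨ y = i.val) :
    addPair S x y = Restr π (i.val + 1) ↔ S = Restr π i.val ∧ permMoves π i = .H ∧
      ((x = i.val ∧ y = (π i).val ∧ y ≤ i.val) ∨
        (x = (π.symm i).val ∧ y = i.val ∧ x ≤ i.val)) := by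
  rw [permMoves_eq_H]
  have hpq := apply_eq_iff_symm π i
  constructor
  · intro h
    have hS' : S = Restr π i.val :=
      eq_restr_of_lt hS (E := fun u v => u = x ∧ v = y) (by rintro _ _ ⟨rfl, rfl⟩; exact hxy)
        (by rw [← h]; intro u v; rfl)
    refine ⟨hS', ?_⟩
    have h1 := (restr_succ π i i (π i)).2
    have h2 := (restr_succ π i (π.symm i) i).2
    have h0 := (restr_succ π i x y).1
    rw [← h] at h1 h2 h0
    simp only [addPair] at h0 h1 h2
    have h3 := hS i (π i)
    have h4 := hS (π.symm i) i
    have h5 := hS x y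
    rw [← hS'] at h0 h1 h2
    grind
  · rintro ⟨h, h1, h2⟩
    funext u v
    apply propext
    rw [restr_succ, h, addPair]
    grind

theorem addPair_addPair_eq_restr_succ_iff (hS : ∀ x y, S x y → x < i.val ∧ y < i.val) {x y : ℕ}
    (hx : x < i.val) (hy : y < i.val) :
    addPair (addPair S x i.val) i.val y = Restr π (i.val + 1) ↔ S = Restr π i.val ∧
      permMoves π i = .D ∧ x = (π.symm i).val ∧ y = (π i).val := by
  rw [permMoves_eq_D]
  have hpq := apply_eq_iff_symm π i
  constructor
  · intro h
    have hS' : S = Restr π i.val :=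
      eq_restr_of_lt hS (E := fun u v => (u = x ∧ v = i.val) ∨ (u = i.val ∧ v = y))
        (by rintro _ _ (⟨rfl, rfl⟩ | ⟨rfl, rfl⟩) <;> simp)
        (by rw [← h]; intro u v; simp only [addPair, or_assoc])
    refine ⟨hS', ?_⟩
    have h1 := (restr_succ π i x i).1
    have h2 := (restr_succ π i i y).1
    rw [← h, ← hS'] at h1 h2
    simp only [addPair] at h1 h2
    have h3 := hS x i
    have h4 := hS i y
    grind
  · rintro ⟨h, h1, h2⟩
    funext u v
    apply propext
    rw [restr_succ, h]
    simp only [addPair]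
    grind

end restr

/-! ### Random choices at a move correspond to extensions of the partial bijection -/

theorem Represents.iff_eq {n m N h S S'} (H : Represents n m N h S) :
    Represents n m N h S' ↔ S = S' :=
  ⟨H.unique, fun e => e ▸ H⟩

/-- The memory after a horizontal move `i`, for the random choice `x ≤ 2 * h`. -/
def memH (n h i : ℕ) (m : ℕ → ℕ) (x : ℕ) : ℕ → ℕ :=
  linkMem n h (x - (x - h)) (h - (x - h)) (pushMem n h i m)

/-- The memory after a down move `i`, for the random choices `r < h` and `s < h`. -/
def memD (n h i : ℕ) (m : ℕ → ℕ) (r s : ℕ) : ℕ → ℕ :=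
  linkMem n (h - 1) r s (linkMem n h r h (pushMem n h i m))

section moves

variable {n h : ℕ} {m : ℕ → ℕ} {i : Fin n} {S : ℕ → ℕ → Prop}

/-- For `x ≤ 2 * h` the truncated differences are `min x h` and `min h (2 * h - x)`. Thus `x` runs
once through the index pairs in which at least one entry is `h`, the position of the freshly pushed
`i`. -/
theorem Represents.memH (H : Represents n m i h S) (x : ℕ) :
    Represents n (memH n h i m x) (i + 1) h (addPair S
      (pushMem n h i m (cellA n (x - (x - h)))) (pushMem n h i m (cellB n (h - (x - h))))) :=
  (H.push i.isLt).link i.isLt (by omega) (by omega)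

theorem Represents.memH_iff (H : Represents n m i h S) {x : ℕ} (hx : x ≤ 2 * h)
    (π : Equiv.Perm (Fin n)) :
    Represents n (_root_.memH n h i m x) (i + 1) h (Restr π (i + 1)) ↔
      S = Restr π i ∧ permMoves π i = .H ∧
        ((x = h ∧ (π i).val = i.val) ∨ (x < h ∧ m (cellA n x) = (π.symm i).val) ∨
          (h < x ∧ m (cellB n (h - (x - h))) = (π i).val)) := by
  rw [(H.memH x).iff_eq, pushMem_cellA, pushMem_cellB]
  have hA := H.A_lt x
  have hB := H.B_lt (h - (x - h))
  have hpq := apply_eq_iff_symm π i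
  rcases lt_trichotomy x h with hxh | rfl | hxh
  · have e1 : x - (x - h) = x := by omega
    have e2 : h - (x - h) = h := by omega
    rw [e1, e2, if_neg (by omega), if_pos rfl, addPair_eq_restr_succ_iff H.lt (Or.inr rfl)]
    have := hA hxh
    refine and_congr_right fun _ => and_congr_right fun _ => ?_
    omega
  · have e1 : x - (x - x) = x := by omega
    rw [e1, if_pos rfl, if_pos rfl, addPair_eq_restr_succ_iff H.lt (Or.inr rfl)]
    refine and_congr_right fun _ => and_congr_right fun _ => ?_
    omega
  · have e1 : x - (x - h) = h := by omega
    rw [e1, if_pos rfl, if_neg (by omega), addPair_eq_restr_succ_iff H.lt (Or.inl rfl)]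
    have := hB (by omega)
    refine and_congr_right fun _ => and_congr_right fun _ => ?_
    omega

/-- The element that `π` pairs with `i` is still open, and a stack lists each open element once, so
its index fixes the choice. -/
theorem Represents.exists_memH (H : Represents n m i h S) (π : Equiv.Perm (Fin n))
    (hS : Represents n m i h (Restr π i)) (hπ : permMoves π i = .H) :
    ∃ x₀ ≤ 2 * h, ∀ x ≤ 2 * h,
      Represents n (_root_.memH n h i m x) (i + 1) h (Restr π (i + 1)) ↔ x = x₀ := by
  have hS' := H.iff_eq.1 hS
  have hp := H.A_surj (π.symm i).val
  have hq := H.B_surj (π i).val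
  rw [hS'] at hp hq
  have hp := fun h => hp h (not_restr_symm π i)
  have hq := fun h => hq h (not_restr_apply π i)
  have hpq := apply_eq_iff_symm π i
  have hH := hπ
  rw [permMoves_eq_H] at hH
  rcases lt_trichotomy (π i).val i.val with h1 | h1 | h1
  · obtain ⟨k, hk, e⟩ := hq h1
    -- The solution `x > h` of `h - (x - h) = k`.
    refine ⟨2 * h - k, by omega, fun x hx => ?_⟩
    rw [H.memH_iff hx]
    have hB := H.B_inj k hk (h - (x - h))
    have hA := H.A_lt x
    constructor
    · rintro ⟨-, -, h2 | h2 | h2⟩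
      · omega
      · have := hA h2.1; omega
      · have := hB (by omega) (by omega); omega
    · rintro rfl
      refine ⟨hS', hπ, Or.inr (Or.inr ⟨by omega, ?_⟩)⟩
      rw [← e]; congr 2; omega
  · refine ⟨h, by omega, fun x hx => ?_⟩
    rw [H.memH_iff hx]
    have hA := H.A_lt x
    have hB := H.B_lt (h - (x - h))
    constructor
    · rintro ⟨-, -, h2 | h2 | h2⟩
      · omega
      · have := hA h2.1; omega
      · have := hB (by omega); omega
    · rintro rfl
      exact ⟨hS', hπ, Or.inl ⟨rfl, h1⟩⟩
  · obtain ⟨k, hk, e⟩ := hp (by omega)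
    refine ⟨k, by omega, fun x hx => ?_⟩
    rw [H.memH_iff hx]
    have hA := H.A_inj k hk x
    have hB := H.B_lt (h - (x - h))
    constructor
    · rintro ⟨-, -, h2 | h2 | h2⟩
      · omega
      · have := hA (by omega) (by omega); omega
      · have := hB (by omega); omega
    · rintro rfl
      exact ⟨hS', hπ, Or.inr (Or.inl ⟨hk, e⟩)⟩

/-- The first link makes `i` the image of entry `r` and moves `i`, the last entry of the first
stack, into slot `r`. This is why the second link uses `r` again: it now gives `i` its image. -/
theorem Represents.memD (H : Represents n m i h S) {r s : ℕ} (hr : r < h) (hs : s < h) :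
    Represents n (memD n h i m r s) (i + 1) (h - 1)
      (addPair (addPair S (m (cellA n r)) i) i (m (cellB n s))) := by
  have h0 : h - 1 + 1 = h := by omega
  have H1 := (H.push i.isLt).link i.isLt (a := r) (b := h) (by omega) (by omega)
  rw [← h0] at H1
  have H2 := H1.link i.isLt (a := r) (b := s) (by omega) (by omega)
  rw [h0] at H2
  have hx : pushMem n h i m (cellA n r) < n := by
    rw [pushMem_cellA, if_neg (by omega)]
    have := H.A_lt r hr
    have := i.isLt
    omega
  rw [linkMem_cellA hx, linkMem_cellB hx, if_pos rfl, if_neg (by omega), pushMem_cellA,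
    pushMem_cellA, pushMem_cellB, pushMem_cellB, if_pos rfl, if_pos rfl, if_neg (by omega),
    if_neg (by omega)] at H2
  exact H2

theorem Represents.memD_iff (H : Represents n m i h S) {r s : ℕ} (hr : r < h) (hs : s < h)
    (π : Equiv.Perm (Fin n)) :
    Represents n (_root_.memD n h i m r s) (i + 1) (h - 1) (Restr π (i + 1)) ↔
      S = Restr π i ∧ permMoves π i = .D ∧
        m (cellA n r) = (π.symm i).val ∧ m (cellB n s) = (π i).val := by
  rw [(H.memD hr hs).iff_eq, addPair_addPair_eq_restr_succ_iff H.lt (H.A_lt r hr) (H.B_lt s hs)]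

theorem Represents.exists_memD (H : Represents n m i h S) (π : Equiv.Perm (Fin n))
    (hS : Represents n m i h (Restr π i)) (hπ : permMoves π i = .D) :
    ∃ r₀ < h, ∃ s₀ < h, ∀ r < h, ∀ s < h,
      Represents n (_root_.memD n h i m r s) (i + 1) (h - 1) (Restr π (i + 1)) ↔
        r = r₀ ∧ s = s₀ := by
  have hS' := H.iff_eq.1 hS
  have hD := hπ
  rw [permMoves_eq_D] at hD
  obtain ⟨k, hk, ek⟩ := H.A_surj (π.symm i).val hD.2 (hS' ▸ not_restr_symm π i)
  obtain ⟨l, hl, el⟩ := H.B_surj (π i).val hD.1 (hS' ▸ not_restr_apply π i)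
  refine ⟨k, hk, l, hl, fun r hr s hs => ?_⟩
  rw [H.memD_iff hr hs, ← ek, ← el]
  constructor
  · rintro ⟨-, -, h1, h2⟩
    exact ⟨H.A_inj _ hr _ hk h1, H.B_inj _ hs _ hl h2⟩
  · rintro ⟨rfl, rfl⟩
    exact ⟨hS', hπ, rfl, rfl⟩

theorem Represents.pushMem_iff (H : Represents n m i h S) (π : Equiv.Perm (Fin n)) :
    Represents n (pushMem n h i m) (i + 1) (h + 1) (Restr π (i + 1)) ↔
      Represents n m i h (Restr π i) ∧ permMoves π i = .U := by
  rw [(H.push i.isLt).iff_eq, H.iff_eq, eq_restr_succ_iff_U H.lt]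

/-- Input and output share the cells below `n`. Only elements up to `i` receive images, so the
unread moves survive. -/
theorem memH_of_lt (H : Represents n m i h S) {x j : ℕ} (hj : j < n) (hij : i.val < j) :
    memH n h i m x j = m j := by
  rw [memH, linkMem_of_lt hj, if_neg, pushMem_of_lt hj]
  have := (H.push i.isLt).A_lt (x - (x - h)) (by omega)
  omega

theorem memD_of_lt (H : Represents n m i h S) {r s j : ℕ} (hr : r < h) (hj : j < n)
    (hij : i.val < j) : memD n h i m r s j = m j := by
  have h1 := (H.push i.isLt).A_lt r (by omega)
  have h2 := ((H.push i.isLt).link i.isLt (a := r) (b := h) (by omega) (by omega)).A_lt r (by omega)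
  rw [memD, linkMem_of_lt hj, if_neg (by omega), linkMem_of_lt hj, if_neg (by omega),
    pushMem_of_lt hj]

end moves

/-! ### Empty stacks: the start, and the permutation read off at the end -/

theorem represents_zero {n : ℕ} {m : ℕ → ℕ} (S : ℕ → ℕ → Prop) (hS : ∀ x y, ¬ S x y) :
    Represents n m 0 0 S := by
  constructor <;> simp [hS]

theorem represents_restr_iff {n : ℕ} {m : ℕ → ℕ} {S : ℕ → ℕ → Prop} (H : Represents n m n 0 S)
    (π : Equiv.Perm (Fin n)) :
    Represents n m n 0 (Restr π n) ↔ (fun j : Fin n => m j) = fun j => (π j).val := by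
  constructor
  · intro h
    funext j
    exact h.val _ _ ⟨j, rfl, rfl, j.isLt, (π j).isLt⟩
  · intro h
    rw [H.iff_eq]
    funext x y
    apply propext
    constructor
    · intro hs
      obtain ⟨hx, hy⟩ := H.lt _ _ hs
      refine ⟨⟨x, hx⟩, rfl, ?_, hx, hy⟩
      rw [← H.val _ _ hs]
      exact (congrFun h ⟨x, hx⟩).symm
    · rintro ⟨j, rfl, rfl, -, -⟩
      obtain ⟨y, hy⟩ : ∃ y, S j y := by
        by_contra! hc
        obtain ⟨k, hk, -⟩ := H.A_surj j j.isLt hc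
        omega
      have e := H.val _ _ hy
      have e' : m j = (π j).val := congrFun h j
      rw [← e', e]
      exact hy

/-- With an empty first stack the partial bijection is total, and an injection of a finite set into
itself is a permutation. -/
theorem Represents.exists_perm {n : ℕ} {m : ℕ → ℕ} {S : ℕ → ℕ → Prop} (H : Represents n m n 0 S) :
    ∃ π : Equiv.Perm (Fin n), (fun j : Fin n => m j) = fun j => (π j).val := by
  have hS : ∀ j : Fin n, S j (m j) := by
    intro j
    obtain ⟨y, hy⟩ : ∃ y, S j y := by
      by_contra! hc
      obtain ⟨k, hk, -⟩ := H.A_surj j j.isLt hc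
      omega
    rwa [H.val _ _ hy]
  let f : Fin n → Fin n := fun j => ⟨m j, (H.lt _ _ (hS j)).2⟩
  have hf : Function.Injective f := by
    intro j j' e
    have e' : m j = m j' := congrArg Fin.val e
    have h1 := hS j
    rw [e'] at h1
    exact Fin.ext (H.inj _ _ _ h1 (hS j'))
  exact ⟨Equiv.ofBijective f (Finite.injective_iff_bijective.1 hf), rfl⟩

/-! ### Runs of programs -/

/-- The effect of an instruction that is neither a jump nor random. -/
def Instr.det (c : Config) : Instr → Config
  | .const d k => c.setReg d k
  | .add d a b => c.setReg d (c.reg a + c.reg b)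
  | .sub d a b => c.setReg d (c.reg a - c.reg b)
  | .load d a => c.setReg d (c.mem (c.reg a))
  | .store a b => c.setMem (c.reg a) (c.reg b)
  | _ => c

/-- The instruction is neither a jump nor random. -/
def Instr.IsStraight : Instr → Prop
  | .jump _ => False
  | .jumpLt _ _ _ => False
  | .rand _ _ => False
  | _ => True

theorem Instr.IsStraight.exec {ins : Instr} (h : ins.IsStraight) (c : Config) :
    ins.exec c = PMF.pure (ins.det c) := by
  cases ins <;> first | rfl | exact h.elim

theorem Instr.IsStraight.pc {ins : Instr} (h : ins.IsStraight) (c : Config) :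
    (ins.det c).pc = c.pc + 1 := by
  cases ins <;> first | rfl | exact h.elim

namespace Program

variable {P : Program}

theorem run_add (s t : ℕ) (c : Config) : P.run (s + t) c = (P.run s c).bind (P.run t) := by
  induction s generalizing c with
  | zero => simp [run]
  | succ s ih =>
    rw [Nat.succ_add, run, run, PMF.bind_bind]
    congr 1
    funext c'
    exact ih c'

theorem step_eq {c : Config} {ins : Instr} (h : P[c.pc]? = some ins) : P.step c = ins.exec c := by
  simp [step, h]

theorem run_halted {c : Config} (h : c.Halted P) (t : ℕ) : P.run t c = PMF.pure c := by
  induction t with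
  | zero => rfl
  | succ t ih =>
    have h' : P[c.pc]? = none := h
    rw [run, step, h', PMF.pure_bind, ih]

theorem run_block (B : List Instr) (hB : ∀ ins ∈ B, ins.IsStraight) (c : Config)
    (h : B <+: P.drop c.pc) (t : ℕ) : P.run (t + B.length) c = P.run t (B.foldl Instr.det c) := by
  induction B generalizing c with
  | nil => rfl
  | cons ins B ih =>
    obtain ⟨R, hR⟩ := h
    have h0 : P[c.pc]? = some ins := by
      have := congrArg (·[0]?) hR
      simpa using this.symm
    have hi := hB ins (by simp)
    rw [List.length_cons, ← add_assoc, run, step_eq h0, hi.exec, PMF.pure_bind, List.foldl_cons]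
    apply ih (fun ins' h' => hB ins' (by simp [h']))
    refine ⟨R, ?_⟩
    rw [hi.pc, ← List.drop_drop, ← hR]
    rfl

theorem run_rand {c : Config} {d a : ℕ} (h : P[c.pc]? = some (.rand d a)) (t : ℕ) :
    P.run (t + 1) c = (PMF.uniformOfFintype (Fin (c.reg a + 1))).bind
      fun x => P.run t (c.setReg d x.val) := by
  rw [run, step_eq h, Instr.exec, PMF.bind_map]
  rfl

theorem run_jump {c : Config} {l : ℕ} (h : P[c.pc]? = some (.jump l)) (t : ℕ) :
    P.run (t + 1) c = P.run t (c.goto l) := by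
  rw [run, step_eq h, Instr.exec, PMF.pure_bind]

theorem run_jumpLt {c : Config} {a b l : ℕ} (h : P[c.pc]? = some (.jumpLt a b l)) (t : ℕ) :
    P.run (t + 1) c = P.run t (if c.reg a < c.reg b then c.goto l else c.goto (c.pc + 1)) := by
  rw [run, step_eq h, Instr.exec, PMF.pure_bind]

/-- All constants of the program are at most `W`. -/
def ConstLE (P : Program) (W : ℕ) : Prop :=
  ∀ ins ∈ P, ∀ d k, ins = .const d k → k ≤ W

end Program

theorem Config.BoundedBy.mono {V W : ℕ} {c : Config} (h : c.BoundedBy V) (hVW : V ≤ W) :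
    c.BoundedBy W :=
  fun j => ⟨(h j).1.trans hVW, (h j).2.trans hVW⟩

theorem Config.BoundedBy.setReg {W : ℕ} {c : Config} (h : c.BoundedBy W) {v : ℕ} (hv : v ≤ W)
    (d : ℕ) : (c.setReg d v).BoundedBy W := by
  intro j
  refine ⟨?_, (h j).2⟩
  simp only [Config.setReg, Function.update_apply]
  split_ifs
  · exact hv
  · exact (h j).1

theorem Config.BoundedBy.setMem {W : ℕ} {c : Config} (h : c.BoundedBy W) {v : ℕ} (hv : v ≤ W)
    (x : ℕ) : (c.setMem x v).BoundedBy W := by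
  intro j
  refine ⟨(h j).1, ?_⟩
  simp only [Config.setMem, Function.update_apply]
  split_ifs
  · exact hv
  · exact (h j).2

theorem Program.step_boundedBy {P : Program} {W : ℕ} (hP : P.ConstLE W) {c c' : Config}
    (h : c.BoundedBy W) (hc : c' ∈ (P.step c).support) : c'.BoundedBy (2 * W) := by
  have h' : c.BoundedBy (2 * W) := h.mono (by omega)
  rw [Program.step] at hc
  split at hc
  · simp only [PMF.support_pure, Set.mem_singleton_iff] at hc
    exact hc ▸ h'
  · rename_i ins he
    have hm := List.mem_of_getElem? he
    cases ins with
    | const d k =>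
      simp only [Instr.exec, PMF.support_pure, Set.mem_singleton_iff] at hc
      have := hP _ hm _ _ rfl
      exact hc ▸ h'.setReg (by omega) _
    | add d a b =>
      simp only [Instr.exec, PMF.support_pure, Set.mem_singleton_iff] at hc
      have h1 := (h a).1
      have h2 := (h b).1
      exact hc ▸ h'.setReg (by omega) _
    | sub d a b =>
      simp only [Instr.exec, PMF.support_pure, Set.mem_singleton_iff] at hc
      have h1 := (h a).1
      exact hc ▸ h'.setReg (by omega) _
    | load d a =>
      simp only [Instr.exec, PMF.support_pure, Set.mem_singleton_iff] at hc
      exact hc ▸ h'.setReg (h' _).2 _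
    | store a b =>
      simp only [Instr.exec, PMF.support_pure, Set.mem_singleton_iff] at hc
      exact hc ▸ h'.setMem (h' _).1 _
    | jump l =>
      simp only [Instr.exec, PMF.support_pure, Set.mem_singleton_iff] at hc
      exact hc ▸ h'
    | jumpLt a b l =>
      simp only [Instr.exec, PMF.support_pure, Set.mem_singleton_iff] at hc
      subst hc
      split_ifs <;> exact h'
    | rand d a =>
      simp only [Instr.exec, PMF.support_map, Set.mem_image] at hc
      obtain ⟨x, -, rfl⟩ := hc
      have h1 := (h a).1
      have h2 := x.isLt
      exact h'.setReg (by omega) _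

theorem Program.run_boundedBy {P : Program} {W : ℕ} (hP : P.ConstLE W) (t : ℕ) {c c' : Config}
    (h : c.BoundedBy W) (hc : c' ∈ (P.run t c).support) : c'.BoundedBy (2 ^ t * W) := by
  induction t generalizing c W with
  | zero =>
    simp only [Program.run, PMF.support_pure, Set.mem_singleton_iff] at hc
    subst hc
    simpa using h
  | succ t ih =>
    rw [Program.run, PMF.mem_support_bind_iff] at hc
    obtain ⟨d, hd, hc⟩ := hc
    have := ih (W := 2 * W) (fun ins hi d k e => (hP ins hi d k e).trans (by omega))
      (step_boundedBy hP h hd) hc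
    rw [pow_succ, mul_assoc]
    exact this

/-! ### The sampling program -/

/-- Link the entries of the two stacks given by the registers `7` and `8`. -/
def linkCode : List Instr :=
  [.sub 2 2 3, .add 4 7 7, .add 4 4 0, .add 5 8 8, .add 5 5 0, .add 5 5 3, .load 6 4, .load 9 5,
    .store 6 9, .add 6 2 2, .add 6 6 0, .load 9 6, .store 4 9, .add 6 6 3, .load 9 6, .store 5 9]

/-- Read the next move and push its index on both stacks. -/
def pushCode : List Instr :=
  [.const 3 1, .load 5 1, .add 4 2 2, .add 4 4 0, .store 4 1, .add 4 4 3, .store 4 1, .add 2 2 3]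

/-- Go to the next move and clear the auxiliary registers. -/
def tailCode : List Instr :=
  [.add 1 1 3, .const 3 0, .const 4 0, .const 5 0, .const 6 0, .const 7 0, .const 8 0, .const 9 0]

/-- The program that samples a permutation that maps into the given Motzkin path. -/
def sampler : Program :=
  -- Position `65` is just past the end, so jumping there halts. Register `3` holds `1`, which
  -- separates the move codes `0`, `1`, `2`: up jumps to the tail at `34`, down to `43`, and
  -- horizontal falls through to `12`.
  [.jumpLt 1 0 2, .jump 65] ++ pushCode ++ [.jumpLt 5 3 34, .jumpLt 3 5 43] ++
  [.sub 6 2 3, .add 9 6 6, .rand 9 9, .sub 5 9 6, .sub 7 9 5, .sub 8 6 5] ++ linkCode ++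
  tailCode ++ [.jump 0] ++
  [.sub 8 2 3, .sub 9 8 3, .rand 7 9] ++ linkCode ++ [.sub 9 2 3, .rand 8 9, .jump 18]

/-- The configuration before move `i`, with stacks of height `h` and memory `m`. -/
def headConfig (n i h : ℕ) (m : ℕ → ℕ) : Config where
  pc := 0
  reg := fun j => if j = 0 then n else if j = 1 then i else if j = 2 then h else 0
  mem := m

theorem foldl_linkCode {c : Config} {n M a b : ℕ} (h0 : c.reg 0 = n) (h2 : c.reg 2 = M + 1)
    (h3 : c.reg 3 = 1) (h7 : c.reg 7 = a) (h8 : c.reg 8 = b) :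
    ∃ c', linkCode.foldl Instr.det c = c' ∧ c'.pc = c.pc + 16 ∧ c'.mem = linkMem n M a b c.mem ∧
      c'.reg 2 = M ∧ ∀ j ∉ [2, 4, 5, 6, 9], c'.reg j = c.reg j := by
  obtain ⟨pc, reg, mem⟩ := c
  subst h0 h7 h8
  dsimp only at h2 h3
  refine ⟨_, rfl, rfl, ?_, ?_, ?_⟩
  · simp [linkCode, Instr.det, Config.setReg, Config.setMem, h2, h3, linkMem, cellA, cellB]
  · simp [linkCode, Instr.det, Config.setReg, Config.setMem, h2, h3]
  · intro j hj
    simp only [List.mem_cons, List.not_mem_nil, or_false, not_or] at hj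
    simp [linkCode, Instr.det, Config.setReg, Config.setMem, hj]

theorem foldl_pushCode {c : Config} {n h i : ℕ} (h0 : c.reg 0 = n) (h1 : c.reg 1 = i)
    (h2 : c.reg 2 = h) :
    ∃ c', pushCode.foldl Instr.det c = c' ∧ c'.pc = c.pc + 8 ∧ c'.mem = pushMem n h i c.mem ∧
      c'.reg 2 = h + 1 ∧ c'.reg 3 = 1 ∧ c'.reg 5 = c.mem i ∧
      ∀ j ∉ [2, 3, 4, 5], c'.reg j = c.reg j := by
  obtain ⟨pc, reg, mem⟩ := c
  subst h0 h1 h2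
  refine ⟨_, rfl, rfl, ?_, ?_, ?_, ?_, ?_⟩
  · simp [pushCode, Instr.det, Config.setReg, Config.setMem, pushMem, cellA, cellB]
  · simp [pushCode, Instr.det, Config.setReg, Config.setMem]
  · simp [pushCode, Instr.det, Config.setReg, Config.setMem]
  · simp [pushCode, Instr.det, Config.setReg, Config.setMem]
  · intro j hj
    simp only [List.mem_cons, List.not_mem_nil, or_false, not_or] at hj
    simp [pushCode, Instr.det, Config.setReg, Config.setMem, hj]

theorem straight_linkCode : ∀ ins ∈ linkCode, ins.IsStraight := by
  simp [linkCode, Instr.IsStraight]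

theorem straight_pushCode : ∀ ins ∈ pushCode, ins.IsStraight := by
  simp [pushCode, Instr.IsStraight]

theorem straight_tailCode : ∀ ins ∈ tailCode, ins.IsStraight := by
  simp [tailCode, Instr.IsStraight]

/-- The registers other than the first ten are empty, and the first four have known contents. -/
structure RegsAre (c : Config) (n i M : ℕ) : Prop where
  r0 : c.reg 0 = n
  r1 : c.reg 1 = i
  r2 : c.reg 2 = M
  r3 : c.reg 3 = 1
  high : ∀ j, 10 ≤ j → c.reg j = 0

/-- Clearing the auxiliary registers makes the state between moves depend only on the index, the
height and the memory; it also resets the size bound on the registers. -/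
theorem run_tailCode {c : Config} {n i M : ℕ} (hc : RegsAre c n i M) (hpc : c.pc = 34) (t : ℕ) :
    sampler.run (t + 9) c = sampler.run t (headConfig n (i + 1) M c.mem) := by
  obtain ⟨pc, reg, mem⟩ := c
  obtain ⟨h0, h1, h2, h3, h4⟩ := hc
  dsimp only at *
  subst hpc
  rw [show t + 9 = (t + 1) + tailCode.length from rfl,
    Program.run_block _ straight_tailCode _ ⟨_, rfl⟩,
    Program.run_jump (l := 0)
      (by simp [tailCode, Instr.det, Config.setReg, sampler, linkCode, pushCode])]
  congr 1
  ext j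
  · rfl
  · simp only [tailCode, Instr.det, Config.setReg, Config.goto, headConfig, List.foldl,
      Function.update_apply]
    by_cases hj : 10 ≤ j
    · have := h4 j hj
      rw [this]
      split_ifs <;> omega
    · have : j < 10 := by omega
      interval_cases j <;> simp [h0, h1, h2, h3]
  · rfl

theorem run_linkCode {c : Config} {n i M : ℕ} (hc : RegsAre c n i (M + 1))
    (hpc : linkCode <+: sampler.drop c.pc) (t : ℕ) :
    ∃ c', sampler.run (t + 16) c = sampler.run t c' ∧ RegsAre c' n i M ∧ c'.pc = c.pc + 16 ∧
      c'.mem = linkMem n M (c.reg 7) (c.reg 8) c.mem ∧ c'.reg 7 = c.reg 7 := by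
  obtain ⟨c', e, h1, h2, h3, h4⟩ := foldl_linkCode hc.r0 hc.r2 hc.r3 rfl rfl
  refine ⟨c', ?_, ⟨?_, ?_, h3, ?_, ?_⟩, h1, h2, ?_⟩
  · rw [← e, ← Program.run_block _ straight_linkCode _ hpc]
    rfl
  · rw [h4 _ (by simp), hc.r0]
  · rw [h4 _ (by simp), hc.r1]
  · rw [h4 _ (by simp), hc.r3]
  · intro j hj
    rw [h4 _ (by simp; omega), hc.high j hj]
  · rw [h4 _ (by simp)]

theorem RegsAre.setReg {c : Config} {n i M d v : ℕ} (hc : RegsAre c n i M) (hd : 3 < d)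
    (hd' : d < 10) : RegsAre (c.setReg d v) n i M := by
  obtain ⟨h0, h1, h2, h3, h4⟩ := hc
  refine ⟨?_, ?_, ?_, ?_, fun j hj => ?_⟩ <;> simp only [Config.setReg] <;>
    rw [Function.update_of_ne (by omega)]
  exacts [h0, h1, h2, h3, h4 j hj]

theorem RegsAre.goto {c : Config} {n i M : ℕ} (hc : RegsAre c n i M) (l : ℕ) :
    RegsAre (c.goto l) n i M :=
  ⟨hc.r0, hc.r1, hc.r2, hc.r3, hc.high⟩

/-- The first instructions of an iteration push the current index and branch on the move. -/
theorem run_pushCode {n i h : ℕ} {m : ℕ → ℕ} (hi : i < n) (t : ℕ) :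
    ∃ c, sampler.run (t + 9) (headConfig n i h m) = sampler.run t c ∧ RegsAre c n i (h + 1) ∧
      c.pc = 10 ∧ c.mem = pushMem n h i m ∧ c.reg 5 = m i := by
  obtain ⟨c, e, h1, h2, h3, h4, h5, h6⟩ :=
    foldl_pushCode (c := (headConfig n i h m).goto 2) (n := n) (h := h) (i := i) rfl rfl rfl
  refine ⟨c, ?_, ⟨?_, ?_, h3, h4, ?_⟩, h1, h2, h5⟩
  · rw [show t + 9 = (t + 8) + 1 from rfl, Program.run_jumpLt (a := 1) (b := 0) (l := 2) rfl,
      if_pos (by simpa [headConfig] using hi), ← e,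
      ← Program.run_block _ straight_pushCode _ ⟨_, rfl⟩]
    rfl
  · rw [h6 _ (by simp)]; rfl
  · rw [h6 _ (by simp)]; rfl
  · intro j hj
    rw [h6 _ (by simp; omega)]
    simp only [Config.goto, headConfig]
    grind

theorem run_U {n i h : ℕ} {m : ℕ → ℕ} (hi : i < n) (hm : m i = 0) (t : ℕ) :
    sampler.run (t + 19) (headConfig n i h m) =
      sampler.run t (headConfig n (i + 1) (h + 1) (pushMem n h i m)) := by
  obtain ⟨c, e, hc, hpc, hmem, h5⟩ := run_pushCode (h := h) (m := m) hi (t + 10)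
  rw [show t + 19 = t + 10 + 9 from rfl, e, show t + 10 = t + 9 + 1 from rfl,
    Program.run_jumpLt (a := 5) (b := 3) (l := 34) (by rw [hpc]; rfl),
    if_pos (by rw [h5, hm, hc.r3]; omega), ← hmem]
  exact run_tailCode (hc.goto 34) rfl t

/-- The linking block at `18` is shared: a horizontal move runs into it, and a down move jumps to it
for its second link. -/
theorem run_link_tail {c : Config} {n i M : ℕ} (hc : RegsAre c n i (M + 1)) (hpc : c.pc = 18)
    (t : ℕ) : sampler.run (t + 25) c =
      sampler.run t (headConfig n (i + 1) M (linkMem n M (c.reg 7) (c.reg 8) c.mem)) := by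
  obtain ⟨c', e, hc', hpc', hm', -⟩ := run_linkCode hc (by rw [hpc]; exact ⟨_, rfl⟩) (t + 9)
  rw [show t + 25 = t + 9 + 16 from rfl, e, run_tailCode hc' (by omega), hm']

theorem run_H {n i h : ℕ} {m : ℕ → ℕ} (hi : i < n) (hm : m i = 1) (t : ℕ) :
    sampler.run (t + 42) (headConfig n i h m) =
      (PMF.uniformOfFintype (Fin (h + h + 1))).bind fun x =>
        sampler.run t (headConfig n (i + 1) h (memH n h i m x.val)) := by
  obtain ⟨⟨pc, reg, mem⟩, e, hc, rfl, rfl, h5⟩ := run_pushCode (h := h) (m := m) hi (t + 33)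
  have h2 := hc.r2
  have h3 := hc.r3
  dsimp only at h2 h3 h5
  rw [show t + 42 = t + 33 + 9 from rfl, e, show t + 33 = t + 32 + 1 from rfl,
    Program.run_jumpLt (a := 5) (b := 3) (l := 34) rfl,
    if_neg (by simp [h5, hm, h3]), show t + 32 = t + 31 + 1 from rfl,
    Program.run_jumpLt (a := 3) (b := 5) (l := 43) rfl,
    if_neg (by simp [Config.goto, h5, hm, h3])]
  let c : Config := ⟨12, reg, pushMem n h i m⟩
  have hc : RegsAre c n i (h + 1) := hc.goto _
  have hr9 : (([.sub 6 2 3, .add 9 6 6] : List Instr).foldl Instr.det c).reg 9 = h + h := by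
    simp [c, Instr.det, Config.setReg, h2, h3]
  have e1 := Program.run_block (P := sampler) [.sub 6 2 3, .add 9 6 6]
    (by simp [Instr.IsStraight]) c ⟨_, rfl⟩ (t + 29)
  refine e1.trans ?_
  rw [show t + 29 = t + 28 + 1 from rfl, Program.run_rand (d := 9) (a := 9) rfl, hr9]
  congr 1
  funext x
  have e2 := Program.run_block (P := sampler) [.sub 5 9 6, .sub 7 9 5, .sub 8 6 5]
    (by simp [Instr.IsStraight])
    ((([.sub 6 2 3, .add 9 6 6] : List Instr).foldl Instr.det c).setReg 9 x.val) ⟨_, rfl⟩ (t + 25)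
  refine e2.trans ?_
  have hc' : RegsAre (([.sub 5 9 6, .sub 7 9 5, .sub 8 6 5] : List Instr).foldl Instr.det
      ((([.sub 6 2 3, .add 9 6 6] : List Instr).foldl Instr.det c).setReg 9 x.val)) n i (h + 1) := by
    simp only [List.foldl, Instr.det]
    iterate 6 refine RegsAre.setReg ?_ (by omega) (by omega)
    exact hc
  rw [run_link_tail hc' rfl]
  congr 2
  simp [c, Instr.det, Config.setReg, h2, h3, memH]

theorem run_D {n i h : ℕ} {m : ℕ → ℕ} (hi : i < n) (hm : m i = 2) (t : ℕ) :
    sampler.run (t + 58) (headConfig n i (h + 1) m) =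
      (PMF.uniformOfFintype (Fin (h + 1))).bind fun r =>
        (PMF.uniformOfFintype (Fin (h + 1))).bind fun s =>
          sampler.run t (headConfig n (i + 1) h (memD n (h + 1) i m r.val s.val)) := by
  obtain ⟨⟨pc, reg, mem⟩, e, hc, rfl, rfl, h5⟩ := run_pushCode (h := h + 1) (m := m) hi (t + 49)
  have h2 := hc.r2
  have h3 := hc.r3
  dsimp only at h2 h3 h5
  rw [show t + 58 = t + 49 + 9 from rfl, e, show t + 49 = t + 48 + 1 from rfl,
    Program.run_jumpLt (a := 5) (b := 3) (l := 34) rfl,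
    if_neg (by simp [h5, hm, h3]), show t + 48 = t + 47 + 1 from rfl,
    Program.run_jumpLt (a := 3) (b := 5) (l := 43) rfl,
    if_pos (by simp [Config.goto, h5, hm, h3])]
  let c : Config := ⟨43, reg, pushMem n (h + 1) i m⟩
  have hc : RegsAre c n i (h + 1 + 1) := hc.goto _
  have hr9 : (([.sub 8 2 3, .sub 9 8 3] : List Instr).foldl Instr.det c).reg 9 = h := by
    simp [c, Instr.det, Config.setReg, h2, h3]
  have e1 := Program.run_block (P := sampler) [.sub 8 2 3, .sub 9 8 3]
    (by simp [Instr.IsStraight]) c ⟨_, rfl⟩ (t + 45)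
  refine e1.trans ?_
  rw [show t + 45 = t + 44 + 1 from rfl, Program.run_rand (d := 7) (a := 9) rfl, hr9]
  congr 1
  funext r
  have hc' : RegsAre ((([.sub 8 2 3, .sub 9 8 3] : List Instr).foldl Instr.det c).setReg 7 r.val)
      n i (h + 1 + 1) := by
    simp only [List.foldl, Instr.det]
    iterate 3 refine RegsAre.setReg ?_ (by omega) (by omega)
    exact hc
  obtain ⟨c₁, e2, hc₁, hpc₁, hm₁, h7₁⟩ := run_linkCode hc' ⟨_, rfl⟩ (t + 28)
  refine e2.trans ?_
  replace hpc₁ : c₁.pc = 62 := hpc₁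
  obtain ⟨pc₁, reg₁, mem₁⟩ := c₁
  dsimp only at hpc₁
  subst hpc₁
  have h2₁ := hc₁.r2
  have h3₁ := hc₁.r3
  simp only [c, List.foldl, Instr.det, Config.setReg, h2, h3] at hm₁ h7₁
  simp at hm₁ h7₁
  dsimp only at h2₁ h3₁
  have e3 := Program.run_block (P := sampler) [.sub 9 2 3]
    (by simp [Instr.IsStraight]) ⟨62, reg₁, mem₁⟩ ⟨_, rfl⟩ (t + 27)
  refine e3.trans ?_
  have hr9 : (([.sub 9 2 3] : List Instr).foldl Instr.det ⟨62, reg₁, mem₁⟩).reg 9 = h := by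
    simp [Instr.det, Config.setReg, h2₁, h3₁]
  rw [show t + 27 = t + 26 + 1 from rfl, Program.run_rand (d := 8) (a := 9) rfl, hr9]
  congr 1
  funext s
  rw [show t + 26 = t + 25 + 1 from rfl, Program.run_jump (l := 18) rfl]
  have hc' : RegsAre ((([.sub 9 2 3] : List Instr).foldl Instr.det ⟨62, reg₁, mem₁⟩).setReg 8 s.val)
      n i (h + 1) := by
    simp only [List.foldl, Instr.det]
    iterate 2 refine RegsAre.setReg ?_ (by omega) (by omega)
    exact hc₁
  refine (run_link_tail (hc'.goto 18) rfl t).trans ?_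
  congr 2
  simp [Instr.det, Config.setReg, Config.goto, memD, h7₁, hm₁]

theorem run_end {n h : ℕ} {m : ℕ → ℕ} (t : ℕ) : sampler.run (t + 2) (headConfig n n h m) =
    PMF.pure ((headConfig n n h m).goto 65) := by
  rw [show t + 2 = t + 1 + 1 from rfl, Program.run_jumpLt (a := 1) (b := 0) (l := 2) rfl,
    if_neg (by simp [headConfig]), Program.run_jump (l := 65) rfl]
  have hh : ((headConfig n n h m).goto 65).Halted sampler :=
    show sampler[65]? = none from rfl
  exact Program.run_halted hh t

theorem sampler_constLE {W : ℕ} (hW : 1 ≤ W) : sampler.ConstLE W := by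
  intro ins h d k e
  subst e
  simp [sampler, pushCode, linkCode, tailCode] at h
  omega

/-! ### Heights and weights -/

section height

variable {n : ℕ}

theorem filter_lt_succ (i : Fin n) :
    (Finset.univ.filter fun j : Fin n => j.val < i.val + 1) =
      insert i (Finset.univ.filter fun j : Fin n => j.val < i.val) := by
  ext j
  simp [Fin.ext_iff]
  omega

theorem filter_le_succ (i : Fin n) :
    (Finset.univ.filter fun j : Fin n => i.val ≤ j.val) =
      insert i (Finset.univ.filter fun j : Fin n => i.val + 1 ≤ j.val) := by
  ext j
  simp [Fin.ext_iff]
  omega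

theorem heightAfter_succ (w : Fin n → Move) (i : Fin n) :
    heightAfter w (i.val + 1) = heightAfter w i.val + (w i).rise := by
  rw [heightAfter, filter_lt_succ, Finset.sum_insert (by simp), add_comm]
  rfl

/-- The number of random outcomes that the sampler draws from in move `i`. -/
def MotzkinPath.choices (mz : MotzkinPath n) (i : Fin n) : ℕ :=
  match mz.move i with
  | .U => 1
  | .D => mz.moveHeight i * mz.moveHeight i
  | .H => 2 * mz.moveHeight i + 1

/-- The number of random outcomes that the sampler draws from in the moves from `i` on. -/
def MotzkinPath.choicesFrom (mz : MotzkinPath n) (i : ℕ) : ℕ :=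
  ∏ j : Fin n with i ≤ j.val, mz.choices j

theorem MotzkinPath.choicesFrom_eq (mz : MotzkinPath n) (i : Fin n) :
    mz.choicesFrom i = mz.choices i * mz.choicesFrom (i + 1) := by
  rw [choicesFrom, filter_le_succ, Finset.prod_insert (by simp)]
  rfl

/-- An up move to height `e + 1` weighs `e + 1` but offers one choice, which turns `e!` into `(e +
1)!`. A down move from `d + 1` weighs `d + 1` but offers `(d + 1) ^ 2` choices, which turns `(d +
1)!` back into `d!`. -/
theorem MotzkinPath.prod_moveWeight (mz : MotzkinPath n) (k : ℕ) (hk : k ≤ n) :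
    ∏ j : Fin n with j.val < k, mz.moveWeight j =
      (heightAfter mz.move k).toNat.factorial * ∏ j : Fin n with j.val < k, mz.choices j := by
  induction k with
  | zero => simp [heightAfter]
  | succ k ih =>
    let i : Fin n := ⟨k, hk⟩
    have h1 := filter_lt_succ i
    have h2 := heightAfter_succ mz.move i
    have h0 := mz.nonneg k (by omega)
    have h0' := mz.nonneg (k + 1) hk
    simp only [i] at h1 h2
    rw [h1, Finset.prod_insert (by simp), Finset.prod_insert (by simp), ih (by omega), h2]
    rw [h2] at h0'
    simp only [moveWeight, choices, moveHeight]
    rw [h2]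
    obtain ⟨e, he⟩ := Int.eq_ofNat_of_zero_le h0
    rw [he] at h0' ⊢
    cases hm : mz.move ⟨k, hk⟩
    · simp only [Move.rise]
      rw [show max (e : ℤ) (e + 1) = ((e + 1 : ℕ) : ℤ) by push_cast; omega,
        show (e : ℤ) + 1 = ((e + 1 : ℕ) : ℤ) by push_cast; rfl, Int.toNat_natCast,
        Int.toNat_natCast, Nat.factorial_succ]
      ring
    · simp only [Move.rise]
      rw [add_zero, max_self, Int.toNat_natCast]
      ring
    · rw [hm] at h0'
      simp only [Move.rise] at h0' ⊢
      obtain ⟨d, rfl⟩ : ∃ d, e = d + 1 := ⟨e - 1, by omega⟩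
      rw [show max ((d + 1 : ℕ) : ℤ) ((d + 1 : ℕ) + -1) = ((d + 1 : ℕ) : ℤ) by omega,
        show ((d + 1 : ℕ) : ℤ) + -1 = (d : ℤ) by omega, Int.toNat_natCast,
        Int.toNat_natCast, Nat.factorial_succ]
      ring

theorem MotzkinPath.choicesFrom_zero (mz : MotzkinPath n) : mz.choicesFrom 0 = mz.weight := by
  have := mz.prod_moveWeight n le_rfl
  rw [mz.final] at this
  simpa [choicesFrom, weight] using this.symm

end height

/-! ### The invariant of the sampler -/

/-- The memory `m` and the height `h` are possible after `i` moves. -/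
structure Stage {n : ℕ} (mz : MotzkinPath n) (i h : ℕ) (m : ℕ → ℕ) : Prop where
  rep : ∃ S, Represents n m i h S
  code : ∀ j : Fin n, i ≤ j.val → m j = (mz.move j).code
  height : heightAfter mz.move i = h
  le : h ≤ i
  mem_le : ∀ j, m j ≤ n + 2

section stage

variable {n : ℕ} {mz : MotzkinPath n} {i : Fin n} {h : ℕ} {m : ℕ → ℕ}

theorem Stage.height_succ (H : Stage mz i h m) :
    heightAfter mz.move (i + 1) = h + (mz.move i).rise := by
  rw [heightAfter_succ, H.height]

theorem Stage.push (H : Stage mz i h m) (hi : mz.move i = .U) :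
    Stage mz (i + 1) (h + 1) (pushMem n h i m) where
  rep := H.rep.imp fun _ R => R.push i.isLt
  code j hj := by rw [pushMem_of_lt j.isLt, H.code j (by omega)]
  height := by rw [H.height_succ, hi, Move.rise]; push_cast; rfl
  le := by have := H.le; omega
  mem_le := pushMem_le H.mem_le (by omega)

theorem Stage.memH (H : Stage mz i h m) (hi : mz.move i = .H) (x : ℕ) :
    Stage mz (i + 1) h (memH n h i m x) where
  rep := by
    obtain ⟨S, R⟩ := H.rep
    exact ⟨_, R.memH x⟩
  code j hj := by
    obtain ⟨S, R⟩ := H.rep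
    rw [memH_of_lt R j.isLt (by omega), H.code j (by omega)]
  height := by rw [H.height_succ, hi, Move.rise, add_zero]
  le := by have := H.le; omega
  mem_le := linkMem_le (pushMem_le H.mem_le (by omega))

theorem Stage.memD (H : Stage mz i (h + 1) m) (hi : mz.move i = .D) {r s : ℕ} (hr : r < h + 1)
    (hs : s < h + 1) : Stage mz (i + 1) h (memD n (h + 1) i m r s) where
  rep := by
    obtain ⟨S, R⟩ := H.rep
    exact ⟨_, R.memD hr hs⟩
  code j hj := by
    obtain ⟨S, R⟩ := H.rep
    rw [memD_of_lt R hr j.isLt (by omega), H.code j (by omega)]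
  height := by rw [H.height_succ, hi, Move.rise]; push_cast; ring
  le := by have := H.le; omega
  mem_le := linkMem_le (linkMem_le (pushMem_le H.mem_le (by omega)))

/-- Since the path never goes below `0`, a down move always finds nonempty stacks to draw from. -/
theorem Stage.pos (H : Stage mz i h m) (hi : mz.move i = .D) : ∃ h', h = h' + 1 := by
  have h0 := mz.nonneg (i + 1) i.isLt
  rw [H.height_succ, hi, Move.rise] at h0
  exact ⟨h - 1, by omega⟩

theorem Stage.final (H : Stage mz n h m) : h = 0 := by
  have := H.height
  rw [mz.final] at this
  exact_mod_cast this.symm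

theorem Stage.initial (mz : MotzkinPath n) : Stage mz 0 0 mz.initial.mem where
  rep := ⟨fun _ _ => False, represents_zero _ (by simp)⟩
  code j _ := by simp [MotzkinPath.initial]
  height := by simp [heightAfter]
  le := le_rfl
  mem_le j := by
    simp only [MotzkinPath.initial]
    split_ifs with hj
    · cases mz.move ⟨j, hj⟩ <;> simp [Move.code]
    · omega

theorem initial_eq (mz : MotzkinPath n) : mz.initial = headConfig n 0 0 mz.initial.mem := by
  ext j
  · rfl
  · simp only [headConfig, MotzkinPath.initial]
    split_ifs <;> rfl
  · rfl

theorem Stage.exists_run (H : Stage mz i h m) : ∃ k ≤ 64,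
    ∀ c ∈ (sampler.run k (headConfig n i h m)).support,
      ∃ h' m', Stage mz (i + 1) h' m' ∧ c = headConfig n (i + 1) h' m' := by
  have hm := H.code i le_rfl
  cases hi : mz.move i
  · refine ⟨0 + 19, by omega, fun c hc => ?_⟩
    rw [run_U i.isLt (by rw [hm, hi, Move.code]), Program.run, PMF.support_pure] at hc
    exact ⟨_, _, H.push hi, hc⟩
  · refine ⟨0 + 42, by omega, fun c hc => ?_⟩
    rw [run_H i.isLt (by rw [hm, hi, Move.code]), PMF.mem_support_bind_iff] at hc
    obtain ⟨x, -, hc⟩ := hc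
    rw [Program.run, PMF.support_pure] at hc
    exact ⟨_, _, H.memH hi x, hc⟩
  · obtain ⟨h, rfl⟩ := H.pos hi
    refine ⟨0 + 58, by omega, fun c hc => ?_⟩
    rw [run_D i.isLt (by rw [hm, hi, Move.code]), PMF.mem_support_bind_iff] at hc
    obtain ⟨r, -, hc⟩ := hc
    rw [PMF.mem_support_bind_iff] at hc
    obtain ⟨s, -, hc⟩ := hc
    rw [Program.run, PMF.support_pure] at hc
    exact ⟨_, _, H.memD hi r.isLt s.isLt, hc⟩

/-- The budget is `64` steps for each remaining move, of which at most `58` are needed, and two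
steps to leave the loop. -/
theorem Stage.mem_support_run {i k : ℕ} (hik : i + k = n) (H : Stage mz i h m) {t : ℕ}
    (ht : 64 * k + 2 ≤ t) : ∀ c ∈ (sampler.run t (headConfig n i h m)).support,
      c.Halted sampler ∧ ∃ π : Equiv.Perm (Fin n), c.output n = fun j => (π j).val := by
  induction k generalizing i h m t with
  | zero =>
    obtain rfl : i = n := by omega
    obtain ⟨t, rfl⟩ : ∃ s, t = s + 2 := ⟨t - 2, by omega⟩
    intro c hc
    rw [run_end, PMF.support_pure, Set.mem_singleton_iff] at hc
    subst hc
    obtain ⟨S, R⟩ := H.rep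
    rw [H.final] at R
    exact ⟨rfl, R.exists_perm⟩
  | succ k ih =>
    have hi : i < n := by omega
    obtain ⟨l, hl, hs⟩ := Stage.exists_run (i := ⟨i, hi⟩) H
    obtain ⟨t, rfl⟩ : ∃ s, t = l + s := ⟨t - l, by omega⟩
    intro c hc
    rw [Program.run_add, PMF.mem_support_bind_iff] at hc
    obtain ⟨c', hc', hc⟩ := hc
    obtain ⟨h', m', H', rfl⟩ := hs c' hc'
    exact ih (by simp only; omega) H' (by omega) c hc

theorem Stage.boundedBy {i : ℕ} (hi : i ≤ n) (H : Stage mz i h m) :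
    (headConfig n i h m).BoundedBy (n + 2) := by
  intro j
  refine ⟨?_, H.mem_le j⟩
  have := H.le
  simp only [headConfig]
  split_ifs <;> omega

/-- One step at most doubles the largest number. The doublings do not accumulate, because within
`64` steps the machine is back in a head configuration, where the bound is `n + 2` again. -/
theorem Stage.run_boundedBy {i k : ℕ} (hik : i + k = n) (H : Stage mz i h m) (t : ℕ) :
    ∀ c ∈ (sampler.run t (headConfig n i h m)).support, c.BoundedBy (2 ^ 64 * (n + 2)) := by
  have short : ∀ s ≤ 64, ∀ c ∈ (sampler.run s (headConfig n i h m)).support,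
      c.BoundedBy (2 ^ 64 * (n + 2)) := by
    intro s hs c hc
    exact (Program.run_boundedBy (sampler_constLE (by omega)) s (H.boundedBy (by omega)) hc).mono
      (Nat.mul_le_mul_right _ (Nat.pow_le_pow_right (by omega) hs))
  induction k generalizing i h m t with
  | zero =>
    by_cases ht : t ≤ 64
    · exact short t ht
    · obtain rfl : i = n := by omega
      -- The machine has halted after two steps, so the bound at time `2` covers all later times.
      have e := run_end (n := i) (h := h) (m := m)
      have := short (0 + 2) (by omega)
      rw [e] at this
      obtain ⟨s, rfl⟩ : ∃ s, t = s + 2 := ⟨t - 2, by omega⟩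
      rwa [e]
  | succ k ih =>
    by_cases ht : t ≤ 64
    · exact short t ht
    have hi : i < n := by omega
    obtain ⟨l, hl, hs⟩ := Stage.exists_run (i := ⟨i, hi⟩) H
    obtain ⟨t, rfl⟩ : ∃ s, t = l + s := ⟨t - l, by omega⟩
    intro c hc
    rw [Program.run_add, PMF.mem_support_bind_iff] at hc
    obtain ⟨c', hc', hc⟩ := hc
    obtain ⟨h', m', H', rfl⟩ := hs c' hc'
    refine ih (by simp only; omega) H' t ?_ c hc
    intro s hs' c hc
    exact (Program.run_boundedBy (sampler_constLE (by omega)) s (H'.boundedBy hi) hc).mono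
      (Nat.mul_le_mul_right _ (Nat.pow_le_pow_right (by omega) hs'))

end stage

/-! ### The distribution of the output -/

theorem PMF.bind_uniform_apply {α : Type*} {k : ℕ} {f : Fin (k + 1) → PMF α} {a : α}
    (x₀ : Fin (k + 1)) {w : ENNReal} (h : ∀ x, f x a = if x = x₀ then w else 0) :
    ((PMF.uniformOfFintype (Fin (k + 1))).bind f) a = ((k + 1 : ℕ) : ENNReal)⁻¹ * w := by
  rw [PMF.bind_apply, tsum_fintype]
  simp [h]

theorem PMF.bind_apply_eq_zero {α β : Type*} {p : PMF β} {f : β → PMF α} {a : α}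
    (h : ∀ x, f x a = 0) : (p.bind f) a = 0 := by
  rw [PMF.bind_apply]
  simp [h]

section distribution

variable {n : ℕ} {mz : MotzkinPath n} {h : ℕ} {m : ℕ → ℕ}

/-- The permutation extends the pairs that `m` represents after `i` moves, and it agrees with the
path from move `i` on. -/
def Compatible (mz : MotzkinPath n) (π : Equiv.Perm (Fin n)) (i h : ℕ) (m : ℕ → ℕ) : Prop :=
  Represents n m i h (Restr π i) ∧ ∀ j : Fin n, i ≤ j.val → permMoves π j = mz.move j

theorem compatible_iff {π : Equiv.Perm (Fin n)} {i : Fin n} : Compatible mz π i h m ↔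
    Represents n m i h (Restr π i) ∧ permMoves π i = mz.move i ∧
      ∀ j : Fin n, i.val + 1 ≤ j.val → permMoves π j = mz.move j := by
  refine and_congr_right fun _ => ?_
  constructor
  · exact fun h => ⟨h i le_rfl, fun j hj => h j (by omega)⟩
  · rintro ⟨h1, h2⟩ j hj
    by_cases e : j = i
    · rw [e, h1]
    · exact h2 j (by have := fun e' => e (Fin.ext e'); omega)

-- Induction on the number of moves left. If `π` is compatible, exactly one outcome of the draws at
-- move `i` keeps it so, which contributes the factor `1 / mz.choices i`; if it is not, no outcome
-- can repair it.
open Classical in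
theorem Stage.map_output {i k : ℕ} (hik : i + k = n) (H : Stage mz i h m) {t : ℕ}
    (ht : 64 * k + 2 ≤ t) (π : Equiv.Perm (Fin n)) :
    (sampler.run t (headConfig n i h m)).map (Config.output n) (fun j => (π j).val) =
      if Compatible mz π i h m then (mz.choicesFrom i : ENNReal)⁻¹ else 0 := by
  induction k generalizing i h m t with
  | zero =>
    obtain rfl : i = n := by omega
    obtain ⟨t, rfl⟩ : ∃ s, t = s + 2 := ⟨t - 2, by omega⟩
    obtain ⟨S, R⟩ := H.rep
    rw [H.final] at R ⊢
    have h1 : mz.choicesFrom i = 1 := by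
      rw [MotzkinPath.choicesFrom, Finset.filter_false_of_mem (by simp), Finset.prod_empty]
    rw [run_end, PMF.pure_map, h1, Nat.cast_one, inv_one, Compatible, represents_restr_iff R]
    have hv : (fun j : Fin i => (π j).val) = Config.output i ((headConfig i i 0 m).goto 65) ↔
        ((fun j : Fin i => m j) = fun j => (π j).val) ∧
          ∀ j : Fin i, i ≤ j.val → permMoves π j = mz.move j :=
      ⟨fun e => ⟨e.symm, fun j hj => absurd j.isLt (by omega)⟩, fun e => e.1.symm⟩
    split_ifs with hc
    · rw [hv.2 hc, PMF.pure_apply_self]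
    · exact PMF.pure_apply_of_ne _ _ fun e => hc (hv.1 e)
  | succ k ih =>
    have hi : i < n := by omega
    obtain ⟨i, rfl⟩ : ∃ j : Fin n, j.val = i := ⟨⟨i, hi⟩, rfl⟩
    have hm := H.code i le_rfl
    have ih' := fun {h m} => @ih h m (i.val + 1) (by omega)
    obtain ⟨S, R⟩ := H.rep
    simp only [compatible_iff]
    rw [mz.choicesFrom_eq, Nat.cast_mul,
      ENNReal.mul_inv (Or.inr (ENNReal.natCast_ne_top _)) (Or.inl (ENNReal.natCast_ne_top _))]
    have hheight := H.height_succ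
    cases hmi : mz.move i
    · obtain ⟨t, rfl⟩ : ∃ s, t = s + 19 := ⟨t - 19, by omega⟩
      rw [run_U i.isLt (by rw [hm, hmi, Move.code]), ih' (H.push hmi) (by omega),
        MotzkinPath.choices, hmi, Nat.cast_one, inv_one, one_mul]
      simp only [Compatible, R.pushMem_iff, and_assoc]
    · obtain ⟨t, rfl⟩ : ∃ s, t = s + 42 := ⟨t - 42, by omega⟩
      have hch : mz.choices i = h + h + 1 := by
        rw [MotzkinPath.choices, hmi, MotzkinPath.moveHeight, hheight, H.height, hmi, Move.rise,
          add_zero, max_self, Int.toNat_natCast]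
        ring
      rw [run_H i.isLt (by rw [hm, hmi, Move.code]), PMF.map_bind, hch]
      have hx := fun x : Fin (h + h + 1) => ih' (t := t) (H.memH hmi x) (by omega)
      split_ifs with hc
      · obtain ⟨hc, hπ, hf⟩ := hc
        obtain ⟨x₀, hx₀, hu⟩ := R.exists_memH π hc hπ
        refine PMF.bind_uniform_apply ⟨x₀, by omega⟩ fun x => ?_
        rw [hx]
        have hu' := hu x (by omega)
        exact if_congr ⟨fun e => Fin.ext (hu'.1 e.1), fun e => ⟨hu'.2 (congrArg Fin.val e), hf⟩⟩
          rfl rfl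
      · refine PMF.bind_apply_eq_zero fun x => ?_
        rw [hx, if_neg]
        rintro ⟨h1, h2⟩
        rw [R.memH_iff (by omega)] at h1
        exact hc ⟨R.iff_eq.2 h1.1, h1.2.1, h2⟩
    · obtain ⟨h, rfl⟩ := H.pos hmi
      obtain ⟨t, rfl⟩ : ∃ s, t = s + 58 := ⟨t - 58, by omega⟩
      have hch : mz.choices i = (h + 1) * (h + 1) := by
        rw [MotzkinPath.choices, hmi, MotzkinPath.moveHeight, hheight, H.height, hmi, Move.rise,
          max_eq_left (by omega), Int.toNat_natCast]
      rw [run_D i.isLt (by rw [hm, hmi, Move.code]), PMF.map_bind, hch, Nat.cast_mul,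
        ENNReal.mul_inv (Or.inr (ENNReal.natCast_ne_top _)) (Or.inl (ENNReal.natCast_ne_top _))]
      have hx := fun r s : Fin (h + 1) => ih' (t := t) (H.memD hmi r.isLt s.isLt) (by omega)
      split_ifs with hc
      · obtain ⟨hc, hπ, hf⟩ := hc
        obtain ⟨r₀, hr₀, s₀, hs₀, hu⟩ := R.exists_memD π hc hπ
        rw [mul_assoc]
        refine PMF.bind_uniform_apply ⟨r₀, hr₀⟩ fun r => ?_
        rw [PMF.map_bind]
        split_ifs with hr
        · refine PMF.bind_uniform_apply ⟨s₀, hs₀⟩ fun s => ?_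
          rw [hx]
          refine if_congr ?_ rfl rfl
          have hu' := hu r r.isLt s s.isLt
          exact ⟨fun e => Fin.ext (hu'.1 e.1).2,
            fun e => ⟨hu'.2 ⟨congrArg Fin.val hr, congrArg Fin.val e⟩, hf⟩⟩
        -- A wrong first draw cannot be corrected by any second one.
        · refine PMF.bind_apply_eq_zero fun s => ?_
          rw [hx, if_neg]
          rintro ⟨h1, -⟩
          exact hr (Fin.ext ((hu r r.isLt s s.isLt).1 h1).1)
      · refine PMF.bind_apply_eq_zero fun r => ?_
        rw [PMF.map_bind]
        refine PMF.bind_apply_eq_zero fun s => ?_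
        rw [hx, if_neg]
        rintro ⟨h1, h2⟩
        have h1 := (R.memD_iff r.isLt s.isLt π).1 h1
        exact hc ⟨R.iff_eq.2 h1.1, h1.2.1, h2⟩

end distribution

/-! ### Uniformity of the output and the number of permutations -/

open Classical in
theorem outputProb_sampler {n : ℕ} (mz : MotzkinPath n) {t : ℕ} (ht : 64 * n + 2 ≤ t)
    (π : Equiv.Perm (Fin n)) :
    outputProb sampler mz t π = if MapsInto π mz then (mz.weight : ENNReal)⁻¹ else 0 := by
  rw [outputProb, initial_eq, (Stage.initial mz).map_output (by omega) ht, mz.choicesFrom_zero]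
  refine if_congr ⟨fun e => funext fun j => e.2 j (by omega), fun e => ⟨?_, fun j _ => ?_⟩⟩ rfl rfl
  · exact represents_zero _ fun x y hxy => by have := restr_lt π x y hxy; omega
  · exact congrFun e j

/-- No mass is lost on other lists of numbers, since every reachable output is the value list of a
permutation. -/
theorem sum_outputProb_sampler {n : ℕ} (mz : MotzkinPath n) {t : ℕ} (ht : 64 * n + 2 ≤ t) :
    ∑ π : Equiv.Perm (Fin n), outputProb sampler mz t π = 1 := by
  let g : Equiv.Perm (Fin n) → Fin n → ℕ := fun π j => (π j).val
  have hg : Function.Injective g := by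
    intro π σ e
    ext j
    exact congrFun e j
  rw [← tsum_fintype (L := .unconditional _), ← ((sampler.run t mz.initial).map (Config.output n)).tsum_coe]
  refine hg.tsum_eq (f := (sampler.run t mz.initial).map (Config.output n)) ?_
  intro v hv
  have hv : v ∈ ((sampler.run t mz.initial).map (Config.output n)).support := hv
  rw [PMF.support_map, initial_eq] at hv
  obtain ⟨c, hc, rfl⟩ := hv
  obtain ⟨-, π, e⟩ := (Stage.initial mz).mem_support_run (by omega) ht c hc
  exact ⟨π, e.symm⟩

/-- With `N` admissible permutations of probability `1 / ω` each, total mass `1` reads `N / ω = 1`.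
-/
theorem card_mapsInto {n : ℕ} (mz : MotzkinPath n) :
    Nat.card {π : Equiv.Perm (Fin n) // MapsInto π mz} = mz.weight := by
  classical
  have h := sum_outputProb_sampler mz le_rfl
  simp only [outputProb_sampler mz le_rfl] at h
  rw [← Finset.sum_filter, Finset.sum_const, nsmul_eq_mul, ← div_eq_mul_inv] at h
  rw [Nat.card_eq_fintype_card, Fintype.card_subtype]
  refine Nat.cast_injective ((ENNReal.div_eq_one_iff (fun h0 => ?_) (ENNReal.natCast_ne_top _)).1 h)
  -- A weight of `0` is impossible: in `ENNReal` a quotient by `0` is `0` or `∞`, never `1`.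
  rw [h0] at h
  by_cases hz : ((Finset.univ.filter fun π : Equiv.Perm (Fin n) => MapsInto π mz).card : ENNReal) = 0
  · simp [hz] at h
  · simp [ENNReal.div_zero hz] at h

theorem corollary1 :
    ∃ (P : Program) (C : ℕ), ∀ (n : ℕ) (mz : MotzkinPath n),
      Nat.card {π : Equiv.Perm (Fin n) // MapsInto π mz} = mz.weight ∧
      HaltsWithin P mz (C * (n + 1)) ∧
      UsesWordsUpTo P mz ((n + 2) ^ C) ∧
      ∀ π : Equiv.Perm (Fin n),
        (MapsInto π mz → outputProb P mz (C * (n + 1)) π = (mz.weight : ENNReal)⁻¹) ∧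
        (¬ MapsInto π mz → outputProb P mz (C * (n + 1)) π = 0) := by
  classical
  -- The constant serves twice: `64 * n + 2 ≤ 65 * (n + 1)` for the time, and `2 ^ 64 * (n + 2) ≤ (n
  -- + 2) ^ 65` for the word size.
  refine ⟨sampler, 65, fun n mz => ⟨card_mapsInto mz, ?_, ?_, fun π => ⟨fun h => ?_, fun h => ?_⟩⟩⟩
  · intro c hc
    rw [initial_eq] at hc
    exact ((Stage.initial mz).mem_support_run (k := n) (by omega) (by omega) c hc).1
  · intro t c hc
    rw [initial_eq] at hc
    refine ((Stage.initial mz).run_boundedBy (k := n) (by omega) t c hc).mono ?_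
    rw [pow_succ (n + 2) 64]
    exact Nat.mul_le_mul_right _ (Nat.pow_le_pow_left (by omega) _)
  · rw [outputProb_sampler mz (by omega), if_pos h]
  · rw [outputProb_sampler mz (by omega), if_neg h]
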